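/- **Projective decompositions and preference.** All Hilbert spaces are finite-dimensional. A projective decomposition on a system $A$ is a finite set of mutually orthogonal projectors on $\mathcal H_A$ that sum to the identity. Given a unitary $U : A\otimes B\to C\otimes D$, a decomposition $\mathbb D_A$ on $A$ exerts an interference influence on a decomposition $\mathbb D_D$ on $D$ if $[P\otimes I_B,\ U^\dagger(I_C\otimes Q)U]\neq 0$ for some $P\in\mathbb D_A$, $Q\in\mathbb D_D$. The decomposition $\mathbb D_A$ is *preferred by $D$ given $U$* if (1) it exerts no interference influence on any projective decomposition on $D$; (2) every projective decomposition on $A$ that contains a projector not commuting with some element of $\mathbb D_A$ exerts an interference influence on at least one projective decomposition on $D$; (3) every projective decomposition on $A$ that satisfies (1) and (2) is contained in the linear span of $\mathbb D_A$. **Circuits and bubbles.** Let $\mathfrak C$ be a finite acyclic circuit of unitary gates on finite-dimensional systems (wires), with total input $G$ and total output $F$, and let the bubble $\mathfrak B=\{A_1,\dots,A_n\}$ be any set of wires of $\mathfrak C$, numbered compatibly with the partial order of the circuit: if $A_k$ can be reached from $A_m$ by passing upwards through one or more gates, then $m<k$. Cut every wire $A_k$ into a part $A_k^{\rm in}$ that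 goes into the incision and a part $A_k^{\rm out}$ that comes out of it (equivalently, insert into every $A_k$ a swap gate with an ancilla). This gives a unitary $$U:\ \Big(\bigotimes_k A_k^{\rm out}\Big)\otimes G\ \to\ \Big(\bigotimes_k A_k^{\rm in}\Big)\otimes F .$$ The preferred set $\mathfrak P(\mathfrak C,\mathfrak B)$ consists, for each $k$, of an outgoing decomposition $\mathbb D_k^{\rm out}$ on $A_k$, preferred by $\bigotimes_m A_m^{\rm in}$ given $U$ (as a decomposition of the input $A_k^{\rm out}$), and an ingoing decomposition $\mathbb D_k^{\rm in}$ on $A_k$, preferred by $\bigotimes_m A_m^{\rm out}$ given $U^\dagger$ (as a decomposition of the input $A_k^{\rm in}$ of $U^\dagger$). For a projector $P$ on a wire of $\mathfrak C$ let $\tilde P=V^\dagger (P\otimes I)V$ be its Heisenberg representation, where $V$ is the evolution in the original circuit $\mathfrak C$ from $G$ to a time slice containing that wire. Decorate $\mathfrak C$ with the $2n$ decompositions, in the order $\mathbb D_1^{\rm in},\mathbb D_1^{\rm out},\mathbb D_2^{\rm in},\mathbb D_2^{\rm out},\dots,\mathbb D_n^{\rm in},\mathbb D_n^{\rm out}$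 from the bottom to the top. There is an interference influence $\mathbb D\to\mathbb D'$ within $\mathfrak P(\mathfrak C,\mathfrak B)$ if $\mathbb D'$ is above $\mathbb D$ in this order and $[\tilde P,\tilde Q]\ne0$ for some $P\in\mathbb D$, $Q\in\mathbb D'$. **Theorem.** The only interference influences that can occur within $\mathfrak P(\mathfrak C,\mathfrak B)$ are of the form $$\mathbb D_m^{\rm in}\to\mathbb D_k^{\rm out}\qquad\text{with } m\le k .$$ In particular: * $[\tilde P,\tilde Q]=0$ for all $m,k$ and all $P\in\mathbb D_m^{\rm out}$, $Q\in\mathbb D_k^{\rm out}$; * $[\tilde P,\tilde Q]=0$ for all $m,k$ and all $P\in\mathbb D_m^{\rm in}$, $Q\in\mathbb D_k^{\rm in}$; * $[\tilde P,\tilde Q]=0$ for all $m<k$ and all $P\in\mathbb D_m^{\rm out}$, $Q\in\mathbb D_k^{\rm in}$. -/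

import Mathlib

open scoped Kronecker Matrix

/-! ### Projective decompositions, interference influences and preference -/

/-- A projective decomposition: a finite set of mutually orthogonal projectors
(self-adjoint idempotents) that sum to the identity operator. -/
structure IsProjectiveDecomposition {a : Type*} [Fintype a] [DecidableEq a]
    (D : Finset (Matrix a a ℂ)) : Prop where
  isStarProjection : ∀ P ∈ D, IsStarProjection P
  orthogonal : ∀ P ∈ D, ∀ Q ∈ D, P ≠ Q → P * Q = 0
  sum_eq_one : ∑ P ∈ D, P = 1

section Preference

variable {a b c d : Type*} [Fintype a] [DecidableEq a] [Fintype b] [DecidableEq b]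
  [Fintype c] [DecidableEq c] [Fintype d] [DecidableEq d]

/-- Interference influence from the decomposition `DA` of the input `A` to the decomposition `DD`
of the output `D` through a unitary `U : A ⊗ B → C ⊗ D`: some Heisenberg projectors
`P ⊗ I_B` and `U† (I_C ⊗ Q) U` do not commute. -/
def HasInterferenceInfluence (U : Matrix (c × d) (a × b) ℂ)
    (DA : Finset (Matrix a a ℂ)) (DD : Finset (Matrix d d ℂ)) : Prop :=
  ∃ P ∈ DA, ∃ Q ∈ DD,
    ¬ Commute (P ⊗ₖ (1 : Matrix b b ℂ)) (Uᴴ * ((1 : Matrix c c ℂ) ⊗ₖ Q) * U)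

/-- First condition for preference: no interference influence on any decomposition of `D`. -/
def ExertsNoInfluence (U : Matrix (c × d) (a × b) ℂ) (DA : Finset (Matrix a a ℂ)) : Prop :=
  ∀ DD : Finset (Matrix d d ℂ), IsProjectiveDecomposition DD → ¬ HasInterferenceInfluence U DA DD

/-- Second condition for preference: every decomposition of `A` that is incompatible with `DA`
exerts an interference influence on at least one decomposition of `D`. -/
def IncompatibleExertInfluence (U : Matrix (c × d) (a × b) ℂ)
    (DA : Finset (Matrix a a ℂ)) : Prop :=
  ∀ DQ : Finset (Matrix a a ℂ), IsProjectiveDecomposition DQ →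
    (∃ P ∈ DA, ∃ Q ∈ DQ, ¬ Commute P Q) →
    ∃ DD : Finset (Matrix d d ℂ), IsProjectiveDecomposition DD ∧ HasInterferenceInfluence U DQ DD

/-- The projective decomposition `DA` of the input `A` is preferred by the output `D` of
`U : A ⊗ B → C ⊗ D`. -/
structure IsPreferred (U : Matrix (c × d) (a × b) ℂ) (DA : Finset (Matrix a a ℂ)) : Prop where
  isProjectiveDecomposition : IsProjectiveDecomposition DA
  exertsNoInfluence : ExertsNoInfluence U DA
  incompatibleExertInfluence : IncompatibleExertInfluence U DA
  finest : ∀ DR : Finset (Matrix a a ℂ), IsProjectiveDecomposition DR →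
    ExertsNoInfluence U DR → IncompatibleExertInfluence U DR →
    (DR : Set (Matrix a a ℂ)) ⊆ Submodule.span ℂ (DA : Set (Matrix a a ℂ))

end Preference

/-! ### Unitary circuits -/

/-- A finite-dimensional unitary circuit with wires `W` and `N` gates. Every wire `w` carries the
Hilbert space `ℂ ^ dim w`; it comes out of the gate `source w`, or is an input of the circuit if
`source w = none`; it goes into the gate `target w`, or is an output of the circuit if
`target w = none`. The gates are numbered in an order in which they can be executed (a topological
order of the acyclic graph that they form), and each is a unitary from the tensor product of its
input wires to the tensor product of its output wires. -/
structure UnitaryCircuit (W : Type*) [Fintype W] [DecidableEq W] (N : ℕ) where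
  dim : W → ℕ
  source : W → Option (Fin N)
  target : W → Option (Fin N)
  source_lt_target : ∀ w g h, source w = some g → target w = some h → g < h
  gate : ∀ g : Fin N, Matrix (∀ w : {w // source w = some g}, Fin (dim w))
    (∀ w : {w // target w = some g}, Fin (dim w)) ℂ
  gate_conjTranspose_mul : ∀ g, (gate g)ᴴ * gate g = 1
  gate_mul_conjTranspose : ∀ g, gate g * (gate g)ᴴ = 1

namespace UnitaryCircuit

variable {W : Type*} [Fintype W] [DecidableEq W] {N : ℕ} (C : UnitaryCircuit W N)

/-- `u` comes before `v` in the circuit: `v` can be reached from `u` by passing upwards through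
one or more gates. This is the (strict) partial order induced by the circuit on its wires. -/
def Precedes : W → W → Prop :=
  Relation.TransGen fun u v => ∃ g, C.target u = some g ∧ C.source v = some g

/-- Operators on the Hilbert space of the wire `w`. -/
abbrev WireOp (w : W) : Type := Matrix (Fin (C.dim w)) (Fin (C.dim w)) ℂ

/-- The wire `w` is present in the time slice `t`, i.e. after the first `t` gates
(those numbered `0, …, t - 1`) have been executed. -/
def Alive (t : ℕ) (w : W) : Prop :=
  (∀ g, C.source w = some g → g.val < t) ∧ (∀ g, C.target w = some g → t ≤ g.val)

instance (t : ℕ) : DecidablePred (C.Alive t) := fun w =>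
  inferInstanceAs (Decidable
    ((∀ g, C.source w = some g → g.val < t) ∧ (∀ g, C.target w = some g → t ≤ g.val)))

/-- The index set of the product basis of the tensor product of all wires in the slice `t`. -/
abbrev State (t : ℕ) : Type _ := ∀ w : {w // C.Alive t w}, Fin (C.dim w)

/-- The first time slice that contains the wire `w`. -/
def birth (w : W) : ℕ := (C.source w).elim 0 fun g => g.val + 1

theorem alive_birth (w : W) : C.Alive (C.birth w) w := by
  refine ⟨fun g hg => by simp [birth, hg], fun h hh => ?_⟩
  cases hs : C.source w with
  | none => simp [birth, hs]
  | some g => simpa [birth, hs] using C.source_lt_target w g h hs hh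

theorem birth_le (w : W) : C.birth w ≤ N := by
  cases hs : C.source w with
  | none => simp [birth, hs]
  | some g => exact (by simp [birth, hs] : C.birth w = g.val + 1).le.trans g.isLt

theorem alive_of_target {t : ℕ} {ht : t < N} {w : W} (h : C.target w = some ⟨t, ht⟩) :
    C.Alive t w :=
  ⟨fun g hg => C.source_lt_target w g _ hg h,
    fun g hg => by rw [h] at hg; cases hg; exact le_rfl⟩

theorem alive_of_source {t : ℕ} {ht : t < N} {w : W} (h : C.source w = some ⟨t, ht⟩) :
    C.Alive (t + 1) w :=
  ⟨fun g hg => by rw [h] at hg; cases hg; exact Nat.lt_succ_self t,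
    fun g hg => C.source_lt_target w _ g h hg⟩

/-- The evolution from the slice `t` to the slice `t + 1`: the gate number `t` on its own wires,
tensored with the identity on all wires that pass by. -/
def step (t : ℕ) (ht : t < N) : Matrix (C.State (t + 1)) (C.State t) ℂ :=
  Matrix.of fun y x =>
    C.gate ⟨t, ht⟩ (fun w => y ⟨w.1, C.alive_of_source w.2⟩)
      (fun w => x ⟨w.1, C.alive_of_target w.2⟩) *
    if ∀ (w : W) (h : C.Alive t w) (h' : C.Alive (t + 1) w), y ⟨w, h'⟩ = x ⟨w, h⟩ then 1 else 0

/-- The unitary evolution from the inputs of the circuit to the slice `t`. -/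
def evolve : (t : ℕ) → t ≤ N → Matrix (C.State t) (C.State 0) ℂ
  | 0, _ => 1
  | t + 1, ht => C.step t ht * evolve t (Nat.le_of_succ_le ht)

/-- `P ⊗ I`: the operator `P` on the wire `w`, acting on the whole slice `t`. -/
def onSlice (t : ℕ) (w : {w // C.Alive t w}) (P : C.WireOp w) :
    Matrix (C.State t) (C.State t) ℂ :=
  Matrix.of fun y x => P (y w) (x w) * if ∀ v, v ≠ w → y v = x v then 1 else 0

/-- The Heisenberg representation, in the circuit, of the operator `P` placed on the wire `w`. -/
def heisenberg (w : W) (P : C.WireOp w) : Matrix (C.State 0) (C.State 0) ℂ :=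
  (C.evolve (C.birth w) (C.birth_le w))ᴴ * C.onSlice (C.birth w) ⟨w, C.alive_birth w⟩ P *
    C.evolve (C.birth w) (C.birth_le w)

/-! ### The broken circuit of a bubble -/

variable (B : Finset W)

/-- The index set of the product basis of one ancilla for each wire of the bubble. As inputs of
the broken circuit the ancillas are the systems `A^out`, as outputs they are the `A^in`. -/
abbrev Ancilla : Type _ := ∀ w : B, Fin (C.dim w)

/-- Exchange of every bubble wire that starts in the slice `t` with its ancilla. -/
def swapMap (t : ℕ) (x : C.Ancilla B × C.State t) : C.Ancilla B × C.State t :=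
  (fun w => if h : C.birth w = t then x.2 ⟨w, h ▸ C.alive_birth w⟩ else x.1 w,
    fun v => if h : v.1 ∈ B ∧ C.birth v = t then x.1 ⟨v.1, h.1⟩ else x.2 v)

/-- The swap gates between the bubble wires that start in the slice `t` and their ancillas. -/
def swapGate (t : ℕ) : Matrix (C.Ancilla B × C.State t) (C.Ancilla B × C.State t) ℂ :=
  Matrix.of fun y x => if y = C.swapMap B t x then 1 else 0

/-- The circuit up to the slice `t`, with a swap gate with an ancilla inserted into every bubble
wire. -/
def brokenEvolve : (t : ℕ) → t ≤ N →
    Matrix (C.Ancilla B × C.State t) (C.Ancilla B × C.State 0) ℂ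
  | 0, _ => C.swapGate B 0
  | t + 1, ht => C.swapGate B (t + 1) *
      ((1 : Matrix (C.Ancilla B) (C.Ancilla B) ℂ) ⊗ₖ C.step t ht) *
      brokenEvolve t (Nat.le_of_succ_le ht)

/-- The single-shot unitary `(⨂ A^out) ⊗ G → (⨂ A^in) ⊗ F` of the broken circuit, where `G` and
`F` are the tensor products of the inputs and of the outputs of the circuit. -/
def broken : Matrix (C.Ancilla B × C.State N) (C.Ancilla B × C.State 0) ℂ :=
  C.brokenEvolve B N le_rfl

/-- An operator `(⨂ A) ⊗ G → (⨂ A) ⊗ F` regarded as an operator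
`A_w ⊗ ((⨂_{v ≠ w} A_v) ⊗ G) → F ⊗ (⨂ A)`. -/
def bipartite {G F : Type*} (w : B) (U : Matrix (C.Ancilla B × F) (C.Ancilla B × G) ℂ) :
    Matrix (F × C.Ancilla B)
      (Fin (C.dim w) × ((∀ v : {v : B // v ≠ w}, Fin (C.dim v.1)) × G)) ℂ :=
  U.submatrix Prod.swap
    fun x => ((Equiv.piSplitAt w fun v : B => Fin (C.dim v)).symm (x.1, x.2.1), x.2.2)

/-- The two sides of the incision in a bubble wire. -/
inductive Side
  | ingoing
  | outgoing

/-- `D` is the preferred set of projective decompositions of the bubble `B`: for each bubble wire,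
the outgoing decomposition is the one preferred by the tensor product of all `A^in` given the
unitary of the broken circuit, and the ingoing one is preferred by the tensor product of all
`A^out` given the inverse of that unitary. -/
def IsPreferredSet (D : Side → ∀ w : B, Finset (C.WireOp w)) : Prop :=
  ∀ w : B, IsPreferred (C.bipartite B w (C.broken B)) (D .outgoing w) ∧
    IsPreferred (C.bipartite B w (C.broken B)ᴴ) (D .ingoing w)

variable {B}

/-- The place of side `s` of the wire number `m` is below that of side `s'` of the wire number `k`
when the circuit is decorated with the decompositions: wires come in the order of their numbers,
and on each wire the outgoing decomposition is placed just after the ingoing one. -/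
def IsBelow {n : ℕ} (s : Side) (m : Fin n) (s' : Side) (k : Fin n) : Prop :=
  m < k ∨ m = k ∧ s = .ingoing ∧ s' = .outgoing

/-- There is an interference influence in the circuit from the decomposition on the side `s` of
the bubble wire `A m` to the decomposition on the side `s'` of the bubble wire `A k`: the latter
is higher in the circuit and their Heisenberg projectors do not all commute. -/
def Influences (D : Side → ∀ w : B, Finset (C.WireOp w)) {n : ℕ} (A : Fin n ≃ B)
    (s : Side) (m : Fin n) (s' : Side) (k : Fin n) : Prop :=
  IsBelow s m s' k ∧ ∃ P ∈ D s (A m), ∃ Q ∈ D s' (A k),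
    ¬ Commute (C.heisenberg (A m) P) (C.heisenberg (A k) Q)

end UnitaryCircuit

/-!
Only the first condition of preference is used, the absence of influence, together with the fact
that the projectors of one decomposition commute.

Let `U` be the unitary of the broken circuit and `V` the evolution in the original one. Gluing the
incisions together again is a partial trace over the ancillas: the partial trace of `U` is `V`, and
if operators are first applied to the ancillas on the input side, the result is the evolution with
these operators inserted into the wires (`partialTrace_broken_mul`). This holds for rank-one
operators by the definition of the swap gates (`broken_apply`) and in general by multilinearity.

An outgoing projector `P` of a preferred set commutes with everything that `U†` carries over from
the `A^in`. Hence `U P = (1 ⊗ v) U` for an operator `v` on the outputs of the circuit, because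
operators that commute with all those on the `A^in` act on the outputs only
(`Matrix.exists_eq_kronecker_one`). Likewise `Q U = U (1 ⊗ ω)` for an ingoing projector `Q`, with
`ω` on the inputs of the circuit. Gluing gives `V P̃ = v V` and `Q̃ = ω` for the Heisenberg
representations `P̃` and `Q̃`.

* Outgoing against outgoing: `U P P' = U P' P` gives `v v' V = v' v V` after gluing, and `v V` is
  `V P̃`, so that the Heisenberg representations commute. Ingoing projectors are treated in the same
  way.
* Outgoing `P` against ingoing `Q` on a later wire: gluing `Q U P` gives the time-ordered product
  `V Q̃ P̃`, whereas `Q U P = U (1 ⊗ ω) P = U P (1 ⊗ ω)` gives `V P̃ Q̃`. This requires that the wire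
  of `Q` does not start in an earlier time slice than that of `P`. If it does, the numbering of the
  wires still excludes that it precedes the wire of `P`, and the two representations commute because
  there is no signalling outside the future (`commute_heisenberg_of_not_precedes`).
-/

/-! ### Tensor products and partial traces of matrices -/

namespace Matrix

/-- The tensor product `⨂ i, M i` of a finite family of operators, in the product basis. -/
def piKronecker {ι : Type*} [Fintype ι] {κ : ι → Type*} (M : ∀ i, Matrix (κ i) (κ i) ℂ) :
    Matrix (∀ i, κ i) (∀ i, κ i) ℂ :=
  of fun y x => ∏ i, M i (y i) (x i)

section PiKronecker

variable {ι : Type*} [Fintype ι] {κ : ι → Type*}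

theorem piKronecker_mul [DecidableEq ι] [∀ i, Fintype (κ i)] (M M' : ∀ i, Matrix (κ i) (κ i) ℂ) :
    piKronecker M * piKronecker M' = piKronecker fun i => M i * M' i := by
  ext y x
  simp only [piKronecker, mul_apply, of_apply, Finset.prod_univ_sum, Fintype.piFinset_univ,
    Finset.prod_mul_distrib]

theorem piKronecker_one [∀ i, DecidableEq (κ i)] :
    piKronecker (fun i => (1 : Matrix (κ i) (κ i) ℂ)) = 1 := by
  ext y x
  simp only [piKronecker, of_apply, one_apply, Finset.prod_boole, Finset.mem_univ, true_imp_iff,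
    funext_iff]

theorem piKronecker_single [∀ i, DecidableEq (κ i)] (a b : ∀ i, κ i) :
    piKronecker (fun i => single (a i) (b i) (1 : ℂ)) = single a b 1 := by
  ext y x
  simp only [piKronecker, of_apply, single_apply, Finset.prod_boole, Finset.mem_univ, true_imp_iff,
    funext_iff, forall_and]

theorem commute_piKronecker [DecidableEq ι] [∀ i, Fintype (κ i)]
    {M M' : ∀ i, Matrix (κ i) (κ i) ℂ} (h : ∀ i, Commute (M i) (M' i)) :
    Commute (piKronecker M) (piKronecker M') := by
  rw [Commute, SemiconjBy, piKronecker_mul, piKronecker_mul]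
  exact congrArg _ (funext h)

theorem piKronecker_update_mul [DecidableEq ι] [∀ i, Fintype (κ i)] [∀ i, DecidableEq (κ i)]
    (M : ∀ i, Matrix (κ i) (κ i) ℂ) (i : ι) (hi : M i = 1) (X : Matrix (κ i) (κ i) ℂ) :
    piKronecker (Function.update M i X) =
      piKronecker (Function.update (fun _ => 1) i X) * piKronecker M := by
  rw [piKronecker_mul]
  congr 1
  funext j
  rcases eq_or_ne j i with rfl | h
  · simp [hi]
  · simp [h]

theorem piKronecker_update_apply [DecidableEq ι] [∀ i, DecidableEq (κ i)] (i : ι)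
    (X : Matrix (κ i) (κ i) ℂ) (y x : ∀ i, κ i) :
    piKronecker (Function.update (fun _ => 1) i X) y x =
      X (y i) (x i) * if ∀ j, j ≠ i → y j = x j then 1 else 0 := by
  rw [piKronecker, of_apply, ← Finset.mul_prod_erase _ _ (Finset.mem_univ i),
    Function.update_self, Finset.prod_congr rfl
      (g := fun j => if y j = x j then (1 : ℂ) else 0), Finset.prod_boole]
  · simp
  · intro j hj
    rw [Function.update_of_ne (Finset.ne_of_mem_erase hj), one_apply]

/-- Splitting of the coordinates of a dependent function into two groups. -/
def splitPi {σ τ : Type*} (s : σ ⊕ τ ≃ ι) (κ : ι → Type*) :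
    (∀ i, κ i) ≃ (∀ i, κ (s (.inl i))) × (∀ j, κ (s (.inr j))) :=
  (Equiv.piCongrLeft κ s).symm.trans (Equiv.sumPiEquivProdPi _)

theorem piKronecker_eq_kronecker {σ τ : Type*} [Fintype σ] [Fintype τ] (s : σ ⊕ τ ≃ ι)
    (M : ∀ i, Matrix (κ i) (κ i) ℂ) :
    piKronecker M = (piKronecker (fun i => M (s (.inl i))) ⊗ₖ
      piKronecker (fun j => M (s (.inr j)))).submatrix (splitPi s κ) (splitPi s κ) := by
  ext y x
  simp only [piKronecker, of_apply, submatrix_apply, kroneckerMap_apply]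
  rw [← Equiv.prod_comp s, Fintype.prod_sum_type]
  rfl

end PiKronecker

/-- Operators that commute with every projective measurement of the second factor act on the first
factor alone. Only the projections onto `e i` and onto `e i + e j` are needed: they generate all
matrix units. -/
theorem exists_eq_kronecker_one {f a : Type*} [Fintype f] [DecidableEq f] [Fintype a]
    [DecidableEq a] (M : Matrix (f × a) (f × a) ℂ)
    (h : ∀ Q : Matrix a a ℂ, IsStarProjection Q → Commute M ((1 : Matrix f f ℂ) ⊗ₖ Q)) :
    ∃ v : Matrix f f ℂ, M = v ⊗ₖ (1 : Matrix a a ℂ) := by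
  have hdiag (i : a) : Commute M ((1 : Matrix f f ℂ) ⊗ₖ single i i (1 : ℂ)) := by
    refine h _ ⟨?_, ?_⟩
    · simp [IsIdempotentElem]
    · simp [isSelfAdjoint_iff, star_eq_conjTranspose]
  have hsingle (i j : a) : Commute M ((1 : Matrix f f ℂ) ⊗ₖ single i j (1 : ℂ)) := by
    rcases eq_or_ne i j with rfl | hij
    · exact hdiag i
    set S : Matrix a a ℂ := single i i 1 + single j j 1 + single i j 1 + single j i 1 with hS
    have hSS : S * S = (2 : ℂ) • S := by
      simp only [hS, mul_add, add_mul, single_mul_single_same, mul_one, ne_eq, hij, hij.symm,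
        not_false_eq_true, single_mul_single_of_ne]
      module
    have hstar : star S = S := by
      simp only [hS, star_eq_conjTranspose, conjTranspose_add, conjTranspose_single, star_one]
      abel
    have hQ : Commute M ((1 : Matrix f f ℂ) ⊗ₖ S) := by
      have := (h ((2⁻¹ : ℂ) • S) ⟨by
        simp [IsIdempotentElem, hSS, smul_smul], by
        simp [isSelfAdjoint_iff, hstar]⟩).smul_right (2 : ℂ)
      rwa [← kronecker_smul, smul_smul, mul_inv_cancel₀ two_ne_zero, one_smul] at this
    have hE : (1 : Matrix f f ℂ) ⊗ₖ single i j (1 : ℂ) =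
        (1 ⊗ₖ single i i (1 : ℂ)) * (1 ⊗ₖ S - 1 ⊗ₖ single i i (1 : ℂ)) := by
      rw [mul_sub, ← mul_kronecker_mul, ← mul_kronecker_mul]
      simp [hS, mul_add, hij, kronecker_add]
    rw [hE]
    exact (hdiag i).mul_right (hQ.sub_right (hdiag i))
  have key (i j k : a) (x y : f) : M (x, k) (y, i) = if k = i then M (x, j) (y, j) else 0 := by
    have := congrFun₂ (hsingle i j).eq (x, k) (y, j)
    simpa [mul_apply, Fintype.sum_prod_type, one_apply, single_apply, ite_and, eq_comm] using this
  rcases isEmpty_or_nonempty a with _ | ⟨⟨j⟩⟩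
  · exact ⟨0, by ext ⟨_, i⟩; exact isEmptyElim i⟩
  · refine ⟨of fun x y => M (x, j) (y, j), ?_⟩
    ext ⟨x, k⟩ ⟨y, i⟩
    rw [key i j k x y]
    simp [one_apply]

/-- The partial trace over the first tensor factor. -/
def partialTrace {a f g : Type*} [Fintype a] (M : Matrix (a × f) (a × g) ℂ) : Matrix f g ℂ :=
  of fun y x => ∑ i, M (i, y) (i, x)

section PartialTrace

variable {a f g h : Type*} [Fintype a]

theorem partialTrace_one_kronecker_mul [DecidableEq a] [Fintype f] (v : Matrix h f ℂ)
    (M : Matrix (a × f) (a × g) ℂ) :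
    partialTrace (((1 : Matrix a a ℂ) ⊗ₖ v) * M) = v * partialTrace M := by
  ext y x
  simp only [partialTrace, of_apply, mul_apply, Fintype.sum_prod_type, kroneckerMap_apply,
    one_apply, ite_mul, one_mul, zero_mul, Finset.mul_sum]
  rw [Finset.sum_comm (s := (Finset.univ : Finset f))]
  refine Finset.sum_congr rfl fun i _ => ?_
  rw [Finset.sum_comm]
  simp

theorem partialTrace_mul_one_kronecker [DecidableEq a] [Fintype g] (M : Matrix (a × f) (a × g) ℂ)
    (v : Matrix g h ℂ) :
    partialTrace (M * ((1 : Matrix a a ℂ) ⊗ₖ v)) = partialTrace M * v := by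
  ext y x
  simp only [partialTrace, of_apply, mul_apply, Fintype.sum_prod_type, kroneckerMap_apply,
    one_apply, ite_mul, one_mul, zero_mul, mul_ite, mul_zero, Finset.sum_mul]
  rw [Finset.sum_comm (s := (Finset.univ : Finset g))]
  refine Finset.sum_congr rfl fun i _ => ?_
  rw [Finset.sum_comm]
  simp

theorem partialTrace_kronecker_one_mul [Fintype f] [DecidableEq f] [Fintype g] [DecidableEq g]
    (X : Matrix a a ℂ) (M : Matrix (a × f) (a × g) ℂ) :
    partialTrace ((X ⊗ₖ (1 : Matrix f f ℂ)) * M) =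
      partialTrace (M * (X ⊗ₖ (1 : Matrix g g ℂ))) := by
  ext y x
  simp only [partialTrace, of_apply, mul_apply, Fintype.sum_prod_type, kroneckerMap_apply,
    one_apply, ite_mul, zero_mul, mul_ite, mul_one, mul_zero, Finset.sum_ite_eq,
    Finset.sum_ite_eq', Finset.mem_univ, if_true]
  rw [Finset.sum_comm]
  exact Finset.sum_congr rfl fun _ _ => Finset.sum_congr rfl fun _ _ => mul_comm _ _

end PartialTrace

end Matrix

namespace UnitaryCircuit

open Matrix

variable {W : Type*} [Fintype W] [DecidableEq W] {N : ℕ} (C : UnitaryCircuit W N)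

/-! ### One gate -/

/-- The wires that pass by the gate number `t`. -/
abbrev Passing (t : ℕ) : Type _ := {w // C.Alive t w ∧ C.Alive (t + 1) w}

theorem alive_succ_of_target_ne {t : ℕ} (ht : t < N) {w : W} (h : C.Alive t w)
    (hw : C.target w ≠ some ⟨t, ht⟩) : C.Alive (t + 1) w := by
  refine ⟨fun g hg => (h.1 g hg).trans (Nat.lt_succ_self t), fun g hg => ?_⟩
  refine Nat.succ_le_of_lt (lt_of_le_of_ne (h.2 g hg) fun hne => hw ?_)
  rw [hg]
  exact congrArg some (Fin.ext hne.symm)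

theorem alive_of_source_ne {t : ℕ} (ht : t < N) {w : W} (h : C.Alive (t + 1) w)
    (hw : C.source w ≠ some ⟨t, ht⟩) : C.Alive t w := by
  refine ⟨fun g hg => lt_of_le_of_ne (Nat.le_of_lt_succ (h.1 g hg)) fun hne => hw ?_,
    fun g hg => (Nat.le_succ t).trans (h.2 g hg)⟩
  rw [hg]
  exact congrArg some (Fin.ext hne)

/-- The slice before the gate `t` consists of the inputs of the gate and the passing wires. -/
def sumTarget (t : ℕ) (ht : t < N) :
    {w // C.target w = some ⟨t, ht⟩} ⊕ C.Passing t ≃ {w // C.Alive t w} where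
  toFun := Sum.elim (fun w => ⟨w.1, C.alive_of_target w.2⟩) fun w => ⟨w.1, w.2.1⟩
  invFun w := if h : C.target w.1 = some ⟨t, ht⟩ then .inl ⟨w.1, h⟩
    else .inr ⟨w.1, w.2, C.alive_succ_of_target_ne ht w.2 h⟩
  left_inv := by
    rintro (⟨w, hw⟩ | ⟨w, hw⟩)
    · simp [hw]
    · have : C.target w ≠ some ⟨t, ht⟩ := fun h => absurd (hw.2.2 _ h) (by simp)
      simp [this]
  right_inv := by
    rintro ⟨w, hw⟩
    by_cases h : C.target w = some ⟨t, ht⟩ <;> simp [h]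

/-- The slice after the gate `t` consists of the outputs of the gate and the passing wires. -/
def sumSource (t : ℕ) (ht : t < N) :
    {w // C.source w = some ⟨t, ht⟩} ⊕ C.Passing t ≃ {w // C.Alive (t + 1) w} where
  toFun := Sum.elim (fun w => ⟨w.1, C.alive_of_source w.2⟩) fun w => ⟨w.1, w.2.2⟩
  invFun w := if h : C.source w.1 = some ⟨t, ht⟩ then .inl ⟨w.1, h⟩
    else .inr ⟨w.1, C.alive_of_source_ne ht w.2 h, w.2⟩
  left_inv := by
    rintro (⟨w, hw⟩ | ⟨w, hw⟩)
    · simp [hw]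
    · have : C.source w ≠ some ⟨t, ht⟩ := fun h => absurd (hw.1.1 _ h) (by simp)
      simp [this]
  right_inv := by
    rintro ⟨w, hw⟩
    by_cases h : C.source w = some ⟨t, ht⟩ <;> simp [h]

/-- The basis of the slice `t`, split at the gate `t`. -/
abbrev splitTarget (t : ℕ) (ht : t < N) : C.State t ≃
    (∀ w : {w // C.target w = some ⟨t, ht⟩}, Fin (C.dim w)) × (∀ w : C.Passing t, Fin (C.dim w)) :=
  splitPi (C.sumTarget t ht) fun w : {w // C.Alive t w} => Fin (C.dim w)

/-- The basis of the slice `t + 1`, split at the gate `t`. -/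
abbrev splitSource (t : ℕ) (ht : t < N) : C.State (t + 1) ≃
    (∀ w : {w // C.source w = some ⟨t, ht⟩}, Fin (C.dim w)) × (∀ w : C.Passing t, Fin (C.dim w)) :=
  splitPi (C.sumSource t ht) fun w : {w // C.Alive (t + 1) w} => Fin (C.dim w)

theorem step_eq (t : ℕ) (ht : t < N) :
    C.step t ht = (C.gate ⟨t, ht⟩ ⊗ₖ (1 : Matrix (∀ w : C.Passing t, Fin (C.dim w)) _ ℂ)).submatrix
      (C.splitSource t ht) (C.splitTarget t ht) := by
  ext y x
  simp only [step, of_apply, submatrix_apply, kroneckerMap_apply, one_apply, funext_iff]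
  congr 1
  refine if_congr ⟨fun h w => h w.1 w.2.1 w.2.2, fun h w h1 h2 => h ⟨w, h1, h2⟩⟩ rfl rfl

theorem step_conjTranspose_mul (t : ℕ) (ht : t < N) : (C.step t ht)ᴴ * C.step t ht = 1 := by
  rw [step_eq, conjTranspose_submatrix, submatrix_mul_equiv, conjTranspose_kronecker,
    ← mul_kronecker_mul, C.gate_conjTranspose_mul]
  simp

theorem step_mul_conjTranspose (t : ℕ) (ht : t < N) : C.step t ht * (C.step t ht)ᴴ = 1 := by
  rw [step_eq, conjTranspose_submatrix, submatrix_mul_equiv, conjTranspose_kronecker,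
    ← mul_kronecker_mul, C.gate_mul_conjTranspose]
  simp

theorem evolve_conjTranspose_mul : ∀ (t : ℕ) (ht : t ≤ N),
    (C.evolve t ht)ᴴ * C.evolve t ht = 1
  | 0, _ => by simp [evolve]
  | t + 1, ht => by
    rw [evolve, conjTranspose_mul, Matrix.mul_assoc, ← Matrix.mul_assoc _ (C.step t ht),
      step_conjTranspose_mul, Matrix.one_mul, evolve_conjTranspose_mul]

theorem evolve_mul_conjTranspose : ∀ (t : ℕ) (ht : t ≤ N),
    C.evolve t ht * (C.evolve t ht)ᴴ = 1
  | 0, _ => by simp [evolve]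
  | t + 1, ht => by
    rw [evolve, conjTranspose_mul, Matrix.mul_assoc, ← Matrix.mul_assoc (C.evolve t _),
      evolve_mul_conjTranspose, Matrix.one_mul, step_mul_conjTranspose]

theorem onSlice_eq (t : ℕ) (w : {w // C.Alive t w}) (P : C.WireOp w) :
    C.onSlice t w P = piKronecker (Function.update (fun _ => 1) w P) := by
  ext y x
  rw [piKronecker_update_apply, onSlice, of_apply]

/-! ### Wires that do not precede one another -/

theorem piKronecker_splitTarget (t : ℕ) (ht : t < N)
    (R : ∀ w : {w // C.Alive t w}, C.WireOp w) :
    piKronecker R = (piKronecker (fun w : {w // C.target w = some ⟨t, ht⟩} =>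
        (R ⟨w.1, C.alive_of_target w.2⟩ : C.WireOp w)) ⊗ₖ
      piKronecker (fun w : C.Passing t => (R ⟨w.1, w.2.1⟩ : C.WireOp w))).submatrix
        (C.splitTarget t ht) (C.splitTarget t ht) :=
  piKronecker_eq_kronecker (C.sumTarget t ht) R

theorem piKronecker_splitSource (t : ℕ) (ht : t < N)
    (R : ∀ w : {w // C.Alive (t + 1) w}, C.WireOp w) :
    piKronecker R = (piKronecker (fun w : {w // C.source w = some ⟨t, ht⟩} =>
        (R ⟨w.1, C.alive_of_source w.2⟩ : C.WireOp w)) ⊗ₖ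
      piKronecker (fun w : C.Passing t => (R ⟨w.1, w.2.2⟩ : C.WireOp w))).submatrix
        (C.splitSource t ht) (C.splitSource t ht) :=
  piKronecker_eq_kronecker (C.sumSource t ht) R

/-- Pulling a product operator back through a gate affects only its factors on the outputs of the
gate, which become a possibly entangled operator on the inputs. -/
theorem step_conj_piKronecker (t : ℕ) (ht : t < N)
    (R : ∀ w : {w // C.Alive (t + 1) w}, C.WireOp w) :
    (C.step t ht)ᴴ * piKronecker R * C.step t ht =
      (((C.gate ⟨t, ht⟩)ᴴ * piKronecker (fun w : {w // C.source w = some ⟨t, ht⟩} =>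
        (R ⟨w.1, C.alive_of_source w.2⟩ : C.WireOp w)) * C.gate ⟨t, ht⟩) ⊗ₖ
          piKronecker (fun w : C.Passing t => (R ⟨w.1, w.2.2⟩ : C.WireOp w))).submatrix
            (C.splitTarget t ht) (C.splitTarget t ht) := by
  rw [step_eq, C.piKronecker_splitSource t ht R, conjTranspose_submatrix,
    submatrix_mul_equiv, submatrix_mul_equiv, conjTranspose_kronecker, ← mul_kronecker_mul,
    ← mul_kronecker_mul, conjTranspose_one, Matrix.one_mul, Matrix.mul_one]

/-- A product operator on the slice `t`, given by its factors on the inputs of the gate `t` and on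
the passing wires. -/
theorem submatrix_piKronecker_kronecker (t : ℕ) (ht : t < N)
    (I : ∀ w : {w // C.target w = some ⟨t, ht⟩}, C.WireOp w) (R : ∀ w : C.Passing t, C.WireOp w) :
    (piKronecker I ⊗ₖ piKronecker R).submatrix (C.splitTarget t ht) (C.splitTarget t ht) =
      piKronecker (fun w : {w // C.Alive t w} =>
        (if h : C.target w.1 = some ⟨t, ht⟩ then I ⟨w.1, h⟩
        else R ⟨w.1, w.2, C.alive_succ_of_target_ne ht w.2 h⟩ : C.WireOp w)) := by
  rw [C.piKronecker_splitTarget t ht]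
  congr 2
  · congr 1
    funext w
    rw [dif_pos w.2]
  · congr 1
    funext w
    have : C.target w.1 ≠ some ⟨t, ht⟩ := fun h => absurd (w.2.2.2 _ h) (by simp)
    rw [dif_neg this]

/-- No superluminal signalling: what is done on the wire `u` cannot be noticed on wires that do not
lie in the future of `u`. -/
theorem commute_heisenberg_piKronecker (u : W) (P : C.WireOp u) (t : ℕ) (hu : C.birth u ≤ t) :
    ∀ (ht : t ≤ N) (R : ∀ w : {w // C.Alive t w}, C.WireOp w),
      (∀ w : {w // C.Alive t w}, w.1 = u ∨ C.Precedes u w.1 → R w = 1) →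
      Commute (C.heisenberg u P) ((C.evolve t ht)ᴴ * piKronecker R * C.evolve t ht) := by
  induction t, hu using Nat.le_induction with
  | base =>
    intro ht R hR
    have hcomm : Commute (C.onSlice (C.birth u) ⟨u, C.alive_birth u⟩ P) (piKronecker R) := by
      rw [onSlice_eq]
      refine commute_piKronecker fun w => ?_
      rcases eq_or_ne w ⟨u, C.alive_birth u⟩ with rfl | hw
      · rw [hR _ (Or.inl rfl)]
        exact Commute.one_right _
      · rw [Function.update_of_ne hw]
        exact Commute.one_left _
    have hV := C.evolve_mul_conjTranspose _ ht
    rw [heisenberg]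
    generalize C.evolve (C.birth u) ht = V at hV ⊢
    generalize C.onSlice (C.birth u) ⟨u, C.alive_birth u⟩ P = X at hcomm ⊢
    generalize piKronecker R = Y at hcomm ⊢
    have conj_mul (X Y : Matrix (C.State (C.birth u)) (C.State (C.birth u)) ℂ) :
        Vᴴ * X * V * (Vᴴ * Y * V) = Vᴴ * (X * Y) * V := by
      rw [Matrix.mul_assoc (Vᴴ * X), ← Matrix.mul_assoc V, ← Matrix.mul_assoc V, hV,
        Matrix.one_mul]
      simp only [Matrix.mul_assoc]
    rw [Commute, SemiconjBy, conj_mul, conj_mul, hcomm.eq]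
  | succ t hu ih =>
    intro ht R hR
    have hV : (C.evolve (t + 1) ht)ᴴ * piKronecker R * C.evolve (t + 1) ht =
        (C.evolve t (Nat.le_of_succ_le ht))ᴴ * ((C.step t ht)ᴴ * piKronecker R * C.step t ht) *
          C.evolve t (Nat.le_of_succ_le ht) := by
      rw [evolve, conjTranspose_mul]
      simp only [Matrix.mul_assoc]
    rw [hV, step_conj_piKronecker]
    have hpass (w : C.Passing t) (hw : w.1 = u ∨ C.Precedes u w.1) :
        R ⟨w.1, w.2.2⟩ = 1 := hR _ hw
    by_cases hin : ∃ v, C.target v = some ⟨t, ht⟩ ∧ (v = u ∨ C.Precedes u v)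
    · -- All outputs of the gate lie in the future of `u`, so `R` is trivial on them.
      obtain ⟨v, hv, hvu⟩ := hin
      have hout : (fun w : {w // C.source w = some ⟨t, ht⟩} =>
          (R ⟨w.1, C.alive_of_source w.2⟩ : C.WireOp w)) = fun _ => 1 := by
        funext w
        refine hR _ (Or.inr ?_)
        rcases hvu with rfl | hvu
        · exact .single ⟨_, hv, w.2⟩
        · exact .tail hvu ⟨_, hv, w.2⟩
      rw [hout, piKronecker_one, Matrix.mul_one, C.gate_conjTranspose_mul,
        ← piKronecker_one, submatrix_piKronecker_kronecker]
      refine ih _ _ fun w hw => ?_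
      split_ifs with h
      · rfl
      · exact hpass _ hw
    · -- No input of the gate lies in the future of `u`, so any operator is allowed on them.
      push Not at hin
      generalize (C.gate ⟨t, ht⟩)ᴴ * piKronecker (fun w : {w // C.source w = some ⟨t, ht⟩} =>
        (R ⟨w.1, C.alive_of_source w.2⟩ : C.WireOp w)) * C.gate ⟨t, ht⟩ = X
      induction X using Matrix.induction_on' with
      | h_zero => simp
      | h_add X Y hX hY =>
        rw [add_kronecker, submatrix_add]
        simp only [Pi.add_apply, Matrix.mul_add, Matrix.add_mul]
        exact hX.add_right hY
      | h_std_basis i j c =>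
        rw [← mul_one c, ← smul_eq_mul, ← smul_single, smul_kronecker, submatrix_smul]
        simp only [Pi.smul_apply, Matrix.mul_smul, Matrix.smul_mul]
        refine Commute.smul_right ?_ c
        rw [← piKronecker_single, submatrix_piKronecker_kronecker]
        refine ih _ _ fun w hw => ?_
        rw [dif_neg fun h => hw.elim (hin _ h).1 (hin _ h).2]
        exact hpass _ hw

theorem commute_heisenberg_of_not_precedes {u v : W} (huv : u ≠ v) (h : ¬ C.Precedes u v)
    (hb : C.birth u ≤ C.birth v) (P : C.WireOp u) (Q : C.WireOp v) :
    Commute (C.heisenberg u P) (C.heisenberg v Q) := by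
  have := C.commute_heisenberg_piKronecker u P (C.birth v) hb (C.birth_le v)
    (Function.update (fun _ => 1) ⟨v, C.alive_birth v⟩ Q) fun w hw => by
      refine Function.update_of_ne ?_ _ _
      rintro rfl
      exact hw.elim (fun e => huv e.symm) h
  rwa [← onSlice_eq] at this

end UnitaryCircuit

namespace UnitaryCircuit

open Matrix

variable {W : Type*} [Fintype W] [DecidableEq W] {N : ℕ} (C : UnitaryCircuit W N)

/-! ### Operators inserted into wires -/

/-- The operators `R w` on all wires `w` that start in the slice `t`. -/
def insertion (R : ∀ w, C.WireOp w) (t : ℕ) : Matrix (C.State t) (C.State t) ℂ :=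
  piKronecker fun w : {w // C.Alive t w} => if C.birth w = t then R w else 1

/-- The evolution to the slice `t` with the operator `R w` inserted at the start of each
wire `w`. -/
def insertedEvolve (R : ∀ w, C.WireOp w) : (t : ℕ) → t ≤ N → Matrix (C.State t) (C.State 0) ℂ
  | 0, _ => C.insertion R 0
  | t + 1, ht => C.insertion R (t + 1) *
      (C.step t ht * insertedEvolve R t (Nat.le_of_succ_le ht))

variable {C}

theorem onSlice_add {t : ℕ} (w : {w // C.Alive t w}) (X Y : C.WireOp w) :
    C.onSlice t w (X + Y) = C.onSlice t w X + C.onSlice t w Y := by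
  ext y x
  simp only [onSlice, of_apply, Matrix.add_apply, add_mul]

theorem onSlice_smul {t : ℕ} (w : {w // C.Alive t w}) (c : ℂ) (X : C.WireOp w) :
    C.onSlice t w (c • X) = c • C.onSlice t w X := by
  ext y x
  simp [onSlice]

theorem insertion_congr {R R' : ∀ w, C.WireOp w} {t : ℕ} (h : ∀ w, C.birth w = t → R w = R' w) :
    C.insertion R t = C.insertion R' t := by
  refine congrArg piKronecker (funext fun w => ?_)
  split_ifs with hw
  exacts [h _ hw, rfl]

theorem insertedEvolve_congr {R R' : ∀ w, C.WireOp w} :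
    ∀ {t : ℕ} {ht : t ≤ N}, (∀ w, C.birth w ≤ t → R w = R' w) →
      C.insertedEvolve R t ht = C.insertedEvolve R' t ht
  | 0, _, h => insertion_congr fun w hw => h w hw.le
  | t + 1, ht, h => by
    rw [insertedEvolve, insertedEvolve, insertion_congr fun w hw => h w hw.le,
      insertedEvolve_congr fun w hw => h w (hw.trans (Nat.le_succ t))]

theorem insertion_eq_one {R : ∀ w, C.WireOp w} {t : ℕ} (h : ∀ w, C.birth w = t → R w = 1) :
    C.insertion R t = 1 := by
  rw [insertion_congr (R' := fun _ => 1) h, ← piKronecker_one]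
  exact congrArg piKronecker (funext fun w => ite_self _)

theorem insertion_update_of_ne {R : ∀ w, C.WireOp w} {u : W} {t : ℕ} (h : C.birth u ≠ t)
    (X : C.WireOp u) : C.insertion (Function.update R u X) t = C.insertion R t :=
  insertion_congr fun w hw => Function.update_of_ne (by rintro rfl; exact h hw) _ _

theorem insertion_update {t : ℕ} (R : ∀ w, C.WireOp w) (u : W) (X : C.WireOp u)
    (hu : C.birth u = t) :
    C.insertion (Function.update R u X) t =
      C.onSlice t ⟨u, hu ▸ C.alive_birth u⟩ X * C.insertion (Function.update R u 1) t := by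
  rw [onSlice_eq, insertion, insertion, ← piKronecker_update_mul _ _ (by simp)]
  congr 1
  funext w
  rcases eq_or_ne w ⟨u, hu ▸ C.alive_birth u⟩ with rfl | hw
  · simp [hu]
  · have : w.1 ≠ u := fun h => hw (Subtype.ext h)
    simp [Function.update_of_ne hw, Function.update_of_ne this]

theorem insertedEvolve_one (C : UnitaryCircuit W N) :
    ∀ (t : ℕ) (ht : t ≤ N), C.insertedEvolve (fun _ => 1) t ht = C.evolve t ht
  | 0, _ => insertion_eq_one fun _ _ => rfl
  | t + 1, ht => by
    rw [insertedEvolve, insertion_eq_one fun _ _ => rfl, Matrix.one_mul, evolve,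
      insertedEvolve_one C t]

theorem insertedEvolve_update_birth (R : ∀ w, C.WireOp w) (u : W) (X : C.WireOp u) :
    ∀ {t : ℕ} {ht : t ≤ N} (hu : C.birth u = t),
      C.insertedEvolve (Function.update R u X) t ht =
        C.onSlice t ⟨u, hu ▸ C.alive_birth u⟩ X * C.insertedEvolve (Function.update R u 1) t ht
  | 0, _, hu => insertion_update R u X hu
  | t + 1, ht, hu => by
    rw [insertedEvolve, insertedEvolve, insertion_update R u X hu, Matrix.mul_assoc,
      insertedEvolve_congr (R := Function.update R u X) (R' := Function.update R u 1)]
    intro w hw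
    have : w ≠ u := by rintro rfl; omega
    rw [Function.update_of_ne this, Function.update_of_ne this]

/-- As a function of the operator inserted into one wire, the evolution is linear. -/
theorem exists_insertedEvolve_update (R : ∀ w, C.WireOp w) (u : W) (t : ℕ) (hu : C.birth u ≤ t) :
    ∀ ht : t ≤ N, ∃ L : Matrix (C.State t) (C.State (C.birth u)) ℂ, ∀ X : C.WireOp u,
      C.insertedEvolve (Function.update R u X) t ht =
        L * C.onSlice (C.birth u) ⟨u, C.alive_birth u⟩ X *
          C.insertedEvolve (Function.update R u 1) (C.birth u) (C.birth_le u) := by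
  induction t, hu using Nat.le_induction with
  | base =>
    intro ht
    refine ⟨1, fun X => ?_⟩
    rw [Matrix.one_mul, insertedEvolve_update_birth R u X rfl]
  | succ t hu ih =>
    intro ht
    obtain ⟨L, hL⟩ := ih (Nat.le_of_succ_le ht)
    refine ⟨C.insertion R (t + 1) * (C.step t ht * L), fun X => ?_⟩
    rw [insertedEvolve, hL X, insertion_update_of_ne (Nat.lt_succ_of_le hu).ne]
    simp only [Matrix.mul_assoc]

/-- If nothing is inserted into wires that start later than `u`, an operator inserted into `u` acts
last, so that it can be moved to the end of the circuit. -/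
theorem insertedEvolve_update (R : ∀ w, C.WireOp w) (u : W)
    (hR : ∀ w, C.birth u < C.birth w → R w = 1) (hu : R u = 1) (X : C.WireOp u) (t : ℕ)
    (hut : C.birth u ≤ t) :
    ∀ ht : t ≤ N, C.insertedEvolve (Function.update R u X) t ht =
      C.evolve t ht * C.heisenberg u X * (C.evolve t ht)ᴴ * C.insertedEvolve R t ht := by
  induction t, hut using Nat.le_induction with
  | base =>
    intro ht
    have hV := C.evolve_mul_conjTranspose _ ht
    rw [insertedEvolve_update_birth R u X rfl, ← hu, Function.update_eq_self, heisenberg]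
    generalize C.evolve (C.birth u) ht = V at hV ⊢
    congr 1
    rw [Matrix.mul_assoc, Matrix.mul_assoc, hV, Matrix.mul_one, ← Matrix.mul_assoc, hV,
      Matrix.one_mul]
  | succ t hut ih =>
    intro ht
    have h1 : C.insertion R (t + 1) = 1 :=
      insertion_eq_one fun w hw => hR w (hw ▸ Nat.lt_succ_of_le hut)
    rw [insertedEvolve, insertedEvolve, insertion_update_of_ne (Nat.lt_succ_of_le hut).ne, h1, ih,
      evolve, conjTranspose_mul, Matrix.one_mul, Matrix.one_mul]
    simp only [Matrix.mul_assoc]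
    rw [← Matrix.mul_assoc _ (C.step t ht), step_conjTranspose_mul, Matrix.one_mul]

end UnitaryCircuit

/-! ### Decompositions without influence -/

theorem ExertsNoInfluence.commute {a b c d : Type*} [Fintype a] [DecidableEq a] [Fintype b]
    [DecidableEq b] [Fintype c] [DecidableEq c] [Fintype d] [DecidableEq d]
    {U : Matrix (c × d) (a × b) ℂ} {DA : Finset (Matrix a a ℂ)} (h : ExertsNoInfluence U DA)
    {P : Matrix a a ℂ} (hP : P ∈ DA) {Q : Matrix d d ℂ} (hQ : IsStarProjection Q) :
    Commute (P ⊗ₖ (1 : Matrix b b ℂ)) (Uᴴ * ((1 : Matrix c c ℂ) ⊗ₖ Q) * U) := by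
  by_cases hne : Q = 1 - Q
  · -- This happens only in dimension zero.
    have hQ0 : Q = 0 := by
      rw [← hQ.isIdempotentElem.eq]
      nth_rewrite 2 [hne]
      rw [mul_sub, mul_one, hQ.isIdempotentElem.eq, sub_self]
    simp [hQ0]
  by_contra hcomm
  refine h {Q, 1 - Q} ⟨?_, ?_, ?_⟩ ⟨P, hP, Q, by simp, hcomm⟩
  · simp only [Finset.mem_insert, Finset.mem_singleton, forall_eq_or_imp, forall_eq]
    exact ⟨hQ, hQ.one_sub⟩
  · have h1 : Q * (1 - Q) = 0 := by rw [mul_sub, mul_one, hQ.isIdempotentElem.eq, sub_self]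
    have h2 : (1 - Q) * Q = 0 := by rw [sub_mul, one_mul, hQ.isIdempotentElem.eq, sub_self]
    simp only [Finset.mem_insert, Finset.mem_singleton]
    rintro _ (rfl | rfl) _ (rfl | rfl) hPQ
    exacts [absurd rfl hPQ, h1, h2, absurd rfl hPQ]
  · rw [Finset.sum_pair hne, add_sub_cancel]

/-- A projector without influence on the output `D` becomes an operator on the output `C` alone
when it is moved through the unitary. -/
theorem ExertsNoInfluence.exists_mul_eq {a b c d : Type*} [Fintype a] [DecidableEq a] [Fintype b]
    [DecidableEq b] [Fintype c] [DecidableEq c] [Fintype d] [DecidableEq d]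
    {U : Matrix (c × d) (a × b) ℂ} (hU : Uᴴ * U = 1) (hU' : U * Uᴴ = 1)
    {DA : Finset (Matrix a a ℂ)} (h : ExertsNoInfluence U DA) {P : Matrix a a ℂ} (hP : P ∈ DA) :
    ∃ v : Matrix c c ℂ, U * (P ⊗ₖ (1 : Matrix b b ℂ)) = (v ⊗ₖ (1 : Matrix d d ℂ)) * U := by
  obtain ⟨v, hv⟩ := Matrix.exists_eq_kronecker_one (U * (P ⊗ₖ (1 : Matrix b b ℂ)) * Uᴴ)
    fun Q hQ => by
      have := congrArg (fun M => U * M * Uᴴ) (h.commute hP hQ).eq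
      have e1 : U * ((P ⊗ₖ (1 : Matrix b b ℂ)) * (Uᴴ * ((1 : Matrix c c ℂ) ⊗ₖ Q) * U)) * Uᴴ =
          U * (P ⊗ₖ (1 : Matrix b b ℂ)) * Uᴴ * (1 ⊗ₖ Q) * (U * Uᴴ) := by
        simp only [Matrix.mul_assoc]
      have e2 : U * (Uᴴ * ((1 : Matrix c c ℂ) ⊗ₖ Q) * U * (P ⊗ₖ (1 : Matrix b b ℂ))) * Uᴴ =
          (U * Uᴴ) * ((1 ⊗ₖ Q) * (U * (P ⊗ₖ (1 : Matrix b b ℂ)) * Uᴴ)) := by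
        simp only [Matrix.mul_assoc]
      simp only [e1, e2, hU', Matrix.one_mul, Matrix.mul_one] at this
      exact this
  refine ⟨v, ?_⟩
  rw [← hv, Matrix.mul_assoc _ Uᴴ, hU, Matrix.mul_one]

namespace UnitaryCircuit

open Matrix

variable {W : Type*} [Fintype W] [DecidableEq W] {N : ℕ} {C : UnitaryCircuit W N} {B : Finset W}

/-- The operator `P` on the ancilla of the bubble wire `w`. -/
def onAncilla (w : B) (P : C.WireOp w) : Matrix (C.Ancilla B) (C.Ancilla B) ℂ :=
  piKronecker (Function.update (fun _ => 1) w P)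

theorem commute_onAncilla {w w' : B} {P : C.WireOp w} {P' : C.WireOp w'} (h : w ≠ w') :
    Commute (onAncilla w P) (onAncilla w' P') := by
  refine commute_piKronecker fun v => ?_
  rcases eq_or_ne v w with rfl | hv
  · rw [Function.update_of_ne h]
    exact Commute.one_right _
  · rw [Function.update_of_ne hv]
    exact Commute.one_left _

theorem onAncilla_mul (w : B) (P P' : C.WireOp w) :
    onAncilla w P * onAncilla w P' = onAncilla w (P * P') := by
  rw [onAncilla, onAncilla, onAncilla, piKronecker_mul]
  congr 1
  funext v
  rcases eq_or_ne v w with rfl | hv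
  · simp
  · simp [hv]

theorem onAncilla_mul_of_ne {w w' : B} (h : w ≠ w') (P : C.WireOp w) (P' : C.WireOp w') :
    onAncilla w P * onAncilla w' P' =
      piKronecker (Function.update (Function.update (fun _ => 1) w P) w' P') := by
  rw [piKronecker_update_mul _ _ (Function.update_of_ne h.symm _ _)]
  exact (commute_onAncilla h).eq

/-- The wire `w` of a bubble, with the other factors collected. -/
def bipartiteEquiv (C : UnitaryCircuit W N) (w : B) (G : Type*) :
    Fin (C.dim w) × ((∀ v : {v : B // v ≠ w}, Fin (C.dim v.1)) × G) ≃ C.Ancilla B × G :=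
  (Equiv.prodAssoc _ _ _).symm.trans
    ((Equiv.piSplitAt w fun v : B => Fin (C.dim v)).symm.prodCongr (Equiv.refl G))

theorem bipartite_eq {F G : Type*} (w : B) (U : Matrix (C.Ancilla B × F) (C.Ancilla B × G) ℂ) :
    C.bipartite B w U = U.submatrix (Equiv.prodComm F (C.Ancilla B)) (bipartiteEquiv C w G) :=
  rfl

theorem onAncilla_kronecker_submatrix {G : Type*} [Fintype G] [DecidableEq G] (w : B)
    (P : C.WireOp w) :
    (onAncilla w P ⊗ₖ (1 : Matrix G G ℂ)).submatrix (bipartiteEquiv C w G)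
      (bipartiteEquiv C w G) = P ⊗ₖ 1 := by
  ext ⟨i, r, g⟩ ⟨i', r', g'⟩
  simp only [bipartiteEquiv, submatrix_apply, kroneckerMap_apply, onAncilla,
    piKronecker_update_apply, Equiv.trans_apply, Equiv.prodCongr_apply, Prod.map,
    Equiv.prodAssoc_symm_apply, one_apply, Prod.mk.injEq, Equiv.refl_apply]
  have h : (∀ j, j ≠ w → (Equiv.piSplitAt w fun v : B => Fin (C.dim v)).symm (i, r) j =
      (Equiv.piSplitAt w fun v : B => Fin (C.dim v)).symm (i', r') j) ↔ r = r' := by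
    constructor
    · intro h
      funext v
      simpa [Equiv.piSplitAt, v.2] using h v.1 v.2
    · rintro rfl j hj
      simp [Equiv.piSplitAt, hj]
  rw [if_congr h rfl rfl]
  by_cases hr : r = r' <;> simp [hr, Equiv.piSplitAt]

/-- A projector without influence on the ancillas becomes an operator on the remaining output when
it is moved through a unitary. -/
theorem exists_mul_onAncilla_eq {F G : Type*} [Fintype F] [DecidableEq F] [Fintype G]
    [DecidableEq G] {w : B} {U : Matrix (C.Ancilla B × F) (C.Ancilla B × G) ℂ}
    (hU : Uᴴ * U = 1) (hU' : U * Uᴴ = 1) {DA : Finset (C.WireOp w)}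
    (h : ExertsNoInfluence (C.bipartite B w U) DA) {P : C.WireOp w} (hP : P ∈ DA) :
    ∃ v : Matrix F F ℂ, U * (onAncilla w P ⊗ₖ (1 : Matrix G G ℂ)) =
      ((1 : Matrix (C.Ancilla B) (C.Ancilla B) ℂ) ⊗ₖ v) * U := by
  obtain ⟨v, hv⟩ := h.exists_mul_eq
    (by rw [bipartite_eq, conjTranspose_submatrix, submatrix_mul_equiv, hU, submatrix_one_equiv])
    (by rw [bipartite_eq, conjTranspose_submatrix, submatrix_mul_equiv, hU', submatrix_one_equiv])
    hP
  refine ⟨v, ?_⟩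
  have hv1 : v ⊗ₖ (1 : Matrix (C.Ancilla B) (C.Ancilla B) ℂ) =
      ((1 : Matrix (C.Ancilla B) (C.Ancilla B) ℂ) ⊗ₖ v).submatrix (Equiv.prodComm F _)
        (Equiv.prodComm F _) := by
    ext ⟨_, _⟩ ⟨_, _⟩
    simp [mul_comm]
  rw [← onAncilla_kronecker_submatrix, bipartite_eq, hv1, submatrix_mul_equiv,
    submatrix_mul_equiv] at hv
  ext y x
  simpa using congrFun₂ hv ((Equiv.prodComm F _).symm y) ((bipartiteEquiv C w G).symm x)

/-! ### The broken circuit -/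

variable (C B) in
theorem swapMap_involutive (t : ℕ) : Function.Involutive (C.swapMap B t) := by
  rintro ⟨a, x⟩
  refine Prod.ext (funext fun w => ?_) (funext fun v => ?_)
  · by_cases h : C.birth w = t <;> simp [swapMap, h]
  · by_cases h : v.1 ∈ B ∧ C.birth v = t
    · simp [swapMap, h]
    · simp only [swapMap, dif_neg h]

variable (C B) in
theorem swapGate_eq (t : ℕ) : C.swapGate B t = (1 : Matrix _ _ ℂ).submatrix (Equiv.refl _)
    (swapMap_involutive C B t).toPerm := by
  ext y x
  simp [swapGate, one_apply]

variable (C B) in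
theorem brokenEvolve_unitary : ∀ (t : ℕ) (ht : t ≤ N),
    (C.brokenEvolve B t ht)ᴴ * C.brokenEvolve B t ht = 1 ∧
      C.brokenEvolve B t ht * (C.brokenEvolve B t ht)ᴴ = 1 := by
  have hs (t : ℕ) : (C.swapGate B t)ᴴ * C.swapGate B t = 1 ∧
      C.swapGate B t * (C.swapGate B t)ᴴ = 1 := by
    simp only [swapGate_eq, conjTranspose_submatrix, submatrix_mul_equiv,
      conjTranspose_one, Matrix.mul_one, submatrix_one_equiv, and_self]
  intro t
  induction t with
  | zero => exact fun _ => hs 0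
  | succ t ih =>
    intro ht
    obtain ⟨h1, h2⟩ := ih (Nat.le_of_succ_le ht)
    obtain ⟨s1, s2⟩ := hs (t + 1)
    have g1 : ((1 : Matrix (C.Ancilla B) (C.Ancilla B) ℂ) ⊗ₖ C.step t ht)ᴴ *
        ((1 : Matrix (C.Ancilla B) (C.Ancilla B) ℂ) ⊗ₖ C.step t ht) = 1 := by
      rw [conjTranspose_kronecker, ← mul_kronecker_mul, step_conjTranspose_mul]
      simp
    have g2 : ((1 : Matrix (C.Ancilla B) (C.Ancilla B) ℂ) ⊗ₖ C.step t ht) *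
        ((1 : Matrix (C.Ancilla B) (C.Ancilla B) ℂ) ⊗ₖ C.step t ht)ᴴ = 1 := by
      rw [conjTranspose_kronecker, ← mul_kronecker_mul, step_mul_conjTranspose]
      simp
    rw [brokenEvolve]
    generalize C.brokenEvolve B t _ = K at *
    generalize C.swapGate B (t + 1) = S at *
    generalize (1 : Matrix (C.Ancilla B) (C.Ancilla B) ℂ) ⊗ₖ C.step t ht = G at *
    constructor
    · rw [conjTranspose_mul, conjTranspose_mul, Matrix.mul_assoc, Matrix.mul_assoc,
        ← Matrix.mul_assoc Sᴴ, ← Matrix.mul_assoc Sᴴ, s1, Matrix.one_mul, ← Matrix.mul_assoc Gᴴ,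
        g1, Matrix.one_mul, h1]
    · rw [conjTranspose_mul, conjTranspose_mul, Matrix.mul_assoc, ← Matrix.mul_assoc K, h2,
        Matrix.one_mul, Matrix.mul_assoc, ← Matrix.mul_assoc G, g2, Matrix.one_mul, s2]

/-- The family of operators that has the value `R w` on the bubble wires and is trivial on the
others. -/
def extendOne (R : ∀ w : B, C.WireOp w) (w : W) : C.WireOp w :=
  if h : w ∈ B then R ⟨w, h⟩ else 1

theorem extendOne_update (R : ∀ w : B, C.WireOp w) (w : B) (X : C.WireOp w) :
    extendOne (Function.update R w X) = Function.update (extendOne R) w.1 X := by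
  funext v
  rcases eq_or_ne v w with rfl | hv
  · simp [extendOne]
  · rw [Function.update_of_ne hv]
    unfold extendOne
    split_ifs with h
    · exact Function.update_of_ne (fun e => hv (congrArg Subtype.val e)) _ _
    · rfl

theorem extendOne_one : extendOne (fun w : B => (1 : C.WireOp w)) = fun _ => 1 :=
  funext fun _ => by simp [extendOne]

/-- The operators `|c w⟩⟨b w|` on the bubble wires. -/
abbrev ketBra (c b : C.Ancilla B) (w : B) : C.WireOp w := single (c w) (b w) 1

/-- For fixed states `c` and `b` of the ancillas before and after it, a swap gate acts on the slice
by rank-one operators. -/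
theorem swapGate_apply (t : ℕ) (b c : C.Ancilla B) (y x : C.State t) :
    C.swapGate B t (b, y) (c, x) = if ∀ w : B, C.birth w ≠ t → b w = c w then
      C.insertion (extendOne (ketBra c b)) t y x else 0 := by
  have h1 : C.insertion (extendOne (ketBra c b)) t y x =
      if ∀ v : {v // C.Alive t v}, if h : v.1 ∈ B ∧ C.birth v = t then
        c ⟨v.1, h.1⟩ = y v ∧ b ⟨v.1, h.1⟩ = x v else y v = x v then 1 else 0 := by
    have : C.insertion (extendOne (ketBra c b)) t y x = ∏ v : {v // C.Alive t v},
        if (if h : v.1 ∈ B ∧ C.birth v = t then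
          c ⟨v.1, h.1⟩ = y v ∧ b ⟨v.1, h.1⟩ = x v else y v = x v) then (1 : ℂ) else 0 := by
      refine Finset.prod_congr rfl fun v _ => ?_
      by_cases ht : C.birth v = t <;> by_cases hB : v.1 ∈ B <;>
        simp [extendOne, ht, hB, one_apply, single_apply]
    rw [this, Finset.prod_boole]
    simp
  rw [h1, ← ite_and, swapGate, of_apply]
  refine if_congr ?_ rfl rfl
  rw [swapMap, Prod.mk.injEq, funext_iff, funext_iff]
  constructor
  · rintro ⟨hb, hy⟩
    refine ⟨fun w hw => by rw [hb w, dif_neg hw], fun v => ?_⟩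
    have hyv := hy v
    split_ifs at hyv ⊢ with h
    · have := hb ⟨v.1, h.1⟩
      rw [dif_pos h.2] at this
      exact ⟨hyv.symm, this⟩
    · exact hyv
  · rintro ⟨hb, hy⟩
    refine ⟨fun w => ?_, fun v => ?_⟩
    · split_ifs with h
      · have := hy ⟨w, h ▸ C.alive_birth w⟩
        rw [dif_pos ⟨w.2, h⟩] at this
        exact this.2
      · exact hb w h
    · have := hy v
      split_ifs at this ⊢
      · exact this.1.symm
      · exact this

end UnitaryCircuit

namespace UnitaryCircuit

open Matrix

variable {W : Type*} [Fintype W] [DecidableEq W] {N : ℕ} {C : UnitaryCircuit W N} {B : Finset W}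

/-- The evolution of the broken circuit, for fixed basis states `a` of the outgoing ends and `b` of
the ingoing ends of the cut wires: the wire `w` is projected onto `b w` and prepared anew in `a w`.
The ancillas of wires that have not been reached yet are unchanged. -/
theorem brokenEvolve_apply (a b : C.Ancilla B) : ∀ (t : ℕ) (ht : t ≤ N) (y : C.State t)
    (x : C.State 0), C.brokenEvolve B t ht (b, y) (a, x) =
      if ∀ w : B, t < C.birth w → b w = a w then
        C.insertedEvolve (extendOne (ketBra a b)) t ht y x else 0 := by
  intro t
  induction t generalizing b with
  | zero =>
    intro ht y x
    rw [brokenEvolve, swapGate_apply]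
    simp only [Nat.pos_iff_ne_zero]
    rfl
  | succ t ih =>
    intro ht y x
    have hL (c : C.Ancilla B) (z : C.State (t + 1)) :
        (((1 : Matrix (C.Ancilla B) (C.Ancilla B) ℂ) ⊗ₖ C.step t ht) *
          C.brokenEvolve B t (Nat.le_of_succ_le ht)) (c, z) (a, x) =
        if ∀ w : B, t < C.birth w → c w = a w then (C.step t ht *
          C.insertedEvolve (extendOne (ketBra a c)) t (Nat.le_of_succ_le ht)) z x else 0 := by
      simp only [mul_apply, Fintype.sum_prod_type, kroneckerMap_apply, one_apply, ite_mul, one_mul,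
        zero_mul, ih]
      rw [Finset.sum_eq_single c]
      · simp only [if_true]
        split_ifs <;> simp
      · intro c' _ hc'
        simp [hc'.symm]
      · simp
    -- The only ancilla state that contributes between the gate and the swap.
    let c₀ : C.Ancilla B := fun w => if C.birth w ≤ t then b w else a w
    rw [brokenEvolve, Matrix.mul_assoc, mul_apply, Fintype.sum_prod_type]
    simp only [hL, swapGate_apply]
    rw [Finset.sum_eq_single c₀]
    · have h1 : (∀ w : B, t < C.birth w → c₀ w = a w) := fun w hw => if_neg hw.not_ge
      have h2 : (∀ w : B, C.birth w ≠ t + 1 → b w = c₀ w) ↔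
          ∀ w : B, t + 1 < C.birth w → b w = a w := by
        refine forall_congr' fun w => ?_
        simp only [c₀]
        split_ifs with h
        · exact ⟨fun _ hw => absurd hw (by omega), fun _ _ => rfl⟩
        · exact ⟨fun hw hw' => hw (by omega), fun hw hw' => hw (by omega)⟩
      simp only [if_pos h1, h2]
      split_ifs with hb
      · rw [insertedEvolve, mul_apply]
        have e1 : C.insertion (extendOne (ketBra c₀ b)) (t + 1) =
            C.insertion (extendOne (ketBra a b)) (t + 1) := by
          refine insertion_congr fun w hw => ?_
          unfold extendOne
          split_ifs with hB
          · simp [ketBra, c₀, hw]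
          · rfl
        have e2 : C.insertedEvolve (extendOne (ketBra a c₀)) t (Nat.le_of_succ_le ht) =
            C.insertedEvolve (extendOne (ketBra a b)) t (Nat.le_of_succ_le ht) := by
          refine insertedEvolve_congr fun w hw => ?_
          unfold extendOne
          split_ifs with hB
          · simp [ketBra, c₀, hw]
          · rfl
        rw [e1, e2]
      · simp
    · intro c _ hc
      refine Finset.sum_eq_zero fun z _ => ?_
      split_ifs with h1 h2
      · refine absurd (funext fun w => ?_) hc
        simp only [c₀]
        split_ifs with h
        · exact (h1 w (by omega)).symm
        · exact h2 w (by omega)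
      all_goals simp
    · simp

theorem broken_apply (a b : C.Ancilla B) (y : C.State N) (x : C.State 0) :
    C.broken B (b, y) (a, x) =
      C.insertedEvolve (extendOne (ketBra a b)) N le_rfl y x := by
  rw [broken, brokenEvolve_apply, if_pos]
  exact fun w hw => absurd (C.birth_le w) hw.not_ge

variable (C B) in
/-- The evolution through the circuit as a function of the operators inserted into the bubble. -/
def insertedMultilinear : MultilinearMap ℂ (fun w : B => C.WireOp w)
    (Matrix (C.State N) (C.State 0) ℂ) :=
  MultilinearMap.mk' (fun R => C.insertedEvolve (extendOne R) N le_rfl)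
    (fun R w X Y => by
      obtain ⟨L, hL⟩ := exists_insertedEvolve_update (extendOne R) w.1 N (C.birth_le w) le_rfl
      simp only [extendOne_update, hL, onSlice_add, Matrix.mul_add, Matrix.add_mul])
    (fun R w c X => by
      obtain ⟨L, hL⟩ := exists_insertedEvolve_update (extendOne R) w.1 N (C.birth_le w) le_rfl
      simp only [extendOne_update, hL, onSlice_smul, Matrix.mul_smul, Matrix.smul_mul])

theorem insertedEvolve_eq_sum (R : ∀ w : B, C.WireOp w) :
    C.insertedEvolve (extendOne R) N le_rfl = ∑ a : C.Ancilla B, ∑ b : C.Ancilla B,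
      piKronecker R a b • C.insertedEvolve (extendOne (ketBra a b)) N le_rfl := by
  have h1 : R = fun w => ∑ i, ∑ j, R w i j • single i j (1 : ℂ) := by
    funext w
    conv_lhs => rw [matrix_eq_sum_single (R w)]
    simp
  change insertedMultilinear C B R = _
  conv_lhs => rw [h1]
  rw [MultilinearMap.map_sum]
  refine Finset.sum_congr rfl fun a _ => ?_
  rw [MultilinearMap.map_sum]
  refine Finset.sum_congr rfl fun b _ => ?_
  rw [MultilinearMap.map_smul_univ]
  rfl

/-- The partial trace over the ancillas glues the two ends of each cut wire together, with the
operator `R w` in between. -/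
theorem partialTrace_broken_mul (R : ∀ w : B, C.WireOp w) :
    partialTrace (C.broken B * (piKronecker R ⊗ₖ (1 : Matrix (C.State 0) (C.State 0) ℂ))) =
      C.insertedEvolve (extendOne R) N le_rfl := by
  rw [insertedEvolve_eq_sum, Finset.sum_comm]
  ext y x
  simp only [partialTrace, of_apply, mul_apply, Fintype.sum_prod_type, kroneckerMap_apply,
    one_apply, mul_ite, mul_one, mul_zero, Finset.sum_ite_eq', Finset.mem_univ, if_true,
    Matrix.sum_apply, Matrix.smul_apply, broken_apply, smul_eq_mul]
  exact Finset.sum_congr rfl fun _ _ => Finset.sum_congr rfl fun _ _ => mul_comm _ _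

theorem partialTrace_broken : partialTrace (C.broken B) = C.evolve N le_rfl := by
  have := partialTrace_broken_mul (C := C) fun w : B => (1 : C.WireOp w)
  rwa [piKronecker_one, one_kronecker_one, Matrix.mul_one, extendOne_one, insertedEvolve_one]
    at this

theorem partialTrace_broken_mul_onAncilla (w : B) (P : C.WireOp w) :
    partialTrace (C.broken B * (onAncilla w P ⊗ₖ (1 : Matrix (C.State 0) (C.State 0) ℂ))) =
      C.evolve N le_rfl * C.heisenberg w P := by
  rw [onAncilla, partialTrace_broken_mul, extendOne_update, extendOne_one,
    insertedEvolve_update _ _ (fun _ _ => rfl) rfl P N (C.birth_le w), insertedEvolve_one,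
    Matrix.mul_assoc, evolve_conjTranspose_mul, Matrix.mul_one]

/-- Closing the incisions puts the operators inserted into two wires in the order of their time
slices. -/
theorem partialTrace_broken_mul_onAncilla_mul {w w' : B} (hw : w ≠ w')
    (hb : C.birth w ≤ C.birth w') (P : C.WireOp w) (Q : C.WireOp w') :
    partialTrace (C.broken B * ((onAncilla w P * onAncilla w' Q) ⊗ₖ
      (1 : Matrix (C.State 0) (C.State 0) ℂ))) =
      C.evolve N le_rfl * (C.heisenberg w' Q * C.heisenberg w P) := by
  rw [onAncilla_mul_of_ne hw, partialTrace_broken_mul, extendOne_update, extendOne_update,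
    extendOne_one, insertedEvolve_update _ w'.1 ?_ ?_ Q N (C.birth_le w'),
    insertedEvolve_update _ _ (fun _ _ => rfl) rfl P N (C.birth_le w), insertedEvolve_one,
    Matrix.mul_assoc _ _ (C.evolve N le_rfl), evolve_conjTranspose_mul, Matrix.mul_one,
    Matrix.mul_assoc _ _ (_ * _), ← Matrix.mul_assoc _ (C.evolve N le_rfl),
    evolve_conjTranspose_mul, Matrix.one_mul, Matrix.mul_assoc]
  · intro v hv
    exact Function.update_of_ne (by rintro rfl; omega) _ _
  · exact Function.update_of_ne (fun h => hw (Subtype.ext h.symm)) _ _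

/-! ### Influences within the preferred set -/

/-- A projector of an outgoing decomposition can be moved to the end of the circuit. -/
theorem exists_broken_mul_onAncilla {D : Side → ∀ w : B, Finset (C.WireOp w)}
    (hD : C.IsPreferredSet B D) {w : B} {P : C.WireOp w} (hP : P ∈ D .outgoing w) :
    ∃ v : Matrix (C.State N) (C.State N) ℂ, C.broken B *
        (onAncilla w P ⊗ₖ (1 : Matrix (C.State 0) (C.State 0) ℂ)) =
        ((1 : Matrix (C.Ancilla B) (C.Ancilla B) ℂ) ⊗ₖ v) * C.broken B :=
  exists_mul_onAncilla_eq (brokenEvolve_unitary C B N le_rfl).1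
    (brokenEvolve_unitary C B N le_rfl).2 (hD w).1.exertsNoInfluence hP

/-- A projector of an ingoing decomposition can be moved to the beginning of the circuit, where it
acts as its Heisenberg representation. -/
theorem onAncilla_mul_broken {D : Side → ∀ w : B, Finset (C.WireOp w)}
    (hD : C.IsPreferredSet B D) {w : B} {Q : C.WireOp w} (hQ : Q ∈ D .ingoing w) :
    (onAncilla w Q ⊗ₖ (1 : Matrix (C.State N) (C.State N) ℂ)) * C.broken B = C.broken B *
        ((1 : Matrix (C.Ancilla B) (C.Ancilla B) ℂ) ⊗ₖ C.heisenberg w Q) := by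
  obtain ⟨h1, h2⟩ : (C.broken B)ᴴ * C.broken B = 1 ∧ C.broken B * (C.broken B)ᴴ = 1 :=
    brokenEvolve_unitary C B N le_rfl
  obtain ⟨v, hv⟩ := exists_mul_onAncilla_eq (U := (C.broken B)ᴴ) (by simpa using h2)
    (by simpa using h1) (hD w).2.exertsNoInfluence hQ
  have h3 : (onAncilla w Q ⊗ₖ (1 : Matrix (C.State N) (C.State N) ℂ)) * C.broken B = C.broken B *
      ((1 : Matrix (C.Ancilla B) (C.Ancilla B) ℂ) ⊗ₖ v) := by
    have := congrArg (fun M => C.broken B * M * C.broken B) hv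
    simp only [← Matrix.mul_assoc, h2, Matrix.one_mul] at this
    rw [this, Matrix.mul_assoc, h1, Matrix.mul_one]
  have h4 := congrArg partialTrace h3
  rw [partialTrace_kronecker_one_mul, partialTrace_broken_mul_onAncilla,
    partialTrace_mul_one_kronecker, partialTrace_broken] at h4
  have h5 := congrArg ((C.evolve N le_rfl)ᴴ * ·) h4
  simp only [← Matrix.mul_assoc, evolve_conjTranspose_mul, Matrix.one_mul] at h5
  rw [h3, h5]

theorem commute_onAncilla_of_mem {D : Side → ∀ w : B, Finset (C.WireOp w)} {s : Side}
    (hD : ∀ w, IsProjectiveDecomposition (D s w)) {w w' : B} {P : C.WireOp w} {Q : C.WireOp w'}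
    (hP : P ∈ D s w) (hQ : Q ∈ D s w') : Commute (onAncilla w P) (onAncilla w' Q) := by
  rcases eq_or_ne w w' with rfl | hw
  · rw [Commute, SemiconjBy, onAncilla_mul, onAncilla_mul]
    rcases eq_or_ne P Q with rfl | hPQ
    · rfl
    · rw [(hD w).orthogonal P hP Q hQ hPQ, (hD w).orthogonal Q hQ P hP hPQ.symm]
  · exact commute_onAncilla hw

/-- Outgoing projectors commute: both can be moved to the end of the circuit, in either order. -/
theorem commute_outgoing {D : Side → ∀ w : B, Finset (C.WireOp w)}
    (hD : C.IsPreferredSet B D) {w w' : B} {P : C.WireOp w} {Q : C.WireOp w'}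
    (hP : P ∈ D .outgoing w) (hQ : Q ∈ D .outgoing w') :
    Commute (C.heisenberg w P) (C.heisenberg w' Q) := by
  have key {w w' : B} {P : C.WireOp w} {Q : C.WireOp w'} {v v' : Matrix (C.State N) (C.State N) ℂ}
      (hv : C.broken B * (onAncilla w P ⊗ₖ (1 : Matrix (C.State 0) (C.State 0) ℂ)) =
          ((1 : Matrix (C.Ancilla B) (C.Ancilla B) ℂ) ⊗ₖ v) * C.broken B)
      (hv' : C.broken B * (onAncilla w' Q ⊗ₖ (1 : Matrix (C.State 0) (C.State 0) ℂ)) =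
          ((1 : Matrix (C.Ancilla B) (C.Ancilla B) ℂ) ⊗ₖ v') * C.broken B) :
      partialTrace (C.broken B * ((onAncilla w P * onAncilla w' Q) ⊗ₖ
        (1 : Matrix (C.State 0) (C.State 0) ℂ))) =
        C.evolve N le_rfl * (C.heisenberg w P * C.heisenberg w' Q) := by
    have hV : C.evolve N le_rfl * C.heisenberg w P = v * C.evolve N le_rfl := by
      rw [← partialTrace_broken_mul_onAncilla, hv, partialTrace_one_kronecker_mul,
        partialTrace_broken]
    have hV' : C.evolve N le_rfl * C.heisenberg w' Q = v' * C.evolve N le_rfl := by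
      rw [← partialTrace_broken_mul_onAncilla, hv', partialTrace_one_kronecker_mul,
        partialTrace_broken]
    have : (onAncilla w P * onAncilla w' Q) ⊗ₖ (1 : Matrix (C.State 0) (C.State 0) ℂ) =
        (onAncilla w P ⊗ₖ (1 : Matrix (C.State 0) (C.State 0) ℂ)) *
          (onAncilla w' Q ⊗ₖ (1 : Matrix (C.State 0) (C.State 0) ℂ)) := by
      rw [← mul_kronecker_mul, Matrix.mul_one]
    rw [this, ← Matrix.mul_assoc, hv, Matrix.mul_assoc, hv', partialTrace_one_kronecker_mul,
      partialTrace_one_kronecker_mul, partialTrace_broken, ← Matrix.mul_assoc _ (C.heisenberg w P),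
      hV, Matrix.mul_assoc, hV']
  obtain ⟨v, hv⟩ := exists_broken_mul_onAncilla hD hP
  obtain ⟨v', hv'⟩ := exists_broken_mul_onAncilla hD hQ
  have h1 := key hv hv'
  rw [(commute_onAncilla_of_mem (fun w => (hD w).1.isProjectiveDecomposition) hP hQ).eq,
    key hv' hv] at h1
  have h2 := congrArg ((C.evolve N le_rfl)ᴴ * ·) h1
  simp only [← Matrix.mul_assoc, evolve_conjTranspose_mul, Matrix.one_mul] at h2
  exact h2.symm

/-- Ingoing projectors commute: both can be moved to the beginning of the circuit, in either
order. -/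
theorem commute_ingoing {D : Side → ∀ w : B, Finset (C.WireOp w)}
    (hD : C.IsPreferredSet B D) {w w' : B} {P : C.WireOp w} {Q : C.WireOp w'}
    (hP : P ∈ D .ingoing w) (hQ : Q ∈ D .ingoing w') :
    Commute (C.heisenberg w P) (C.heisenberg w' Q) := by
  have key {w w' : B} {P : C.WireOp w} {Q : C.WireOp w'}
      (hP : P ∈ D .ingoing w) (hQ : Q ∈ D .ingoing w') :
      partialTrace (((onAncilla w P * onAncilla w' Q) ⊗ₖ
        (1 : Matrix (C.State N) (C.State N) ℂ)) * C.broken B) =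
        C.evolve N le_rfl * (C.heisenberg w P * C.heisenberg w' Q) := by
    have : (onAncilla w P * onAncilla w' Q) ⊗ₖ (1 : Matrix (C.State N) (C.State N) ℂ) =
        (onAncilla w P ⊗ₖ (1 : Matrix (C.State N) (C.State N) ℂ)) *
          (onAncilla w' Q ⊗ₖ (1 : Matrix (C.State N) (C.State N) ℂ)) := by
      rw [← mul_kronecker_mul, Matrix.mul_one]
    rw [this, Matrix.mul_assoc, onAncilla_mul_broken hD hQ, ← Matrix.mul_assoc,
      onAncilla_mul_broken hD hP, Matrix.mul_assoc, ← mul_kronecker_mul, Matrix.mul_one,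
      partialTrace_mul_one_kronecker, partialTrace_broken]
  have h1 := key hP hQ
  rw [(commute_onAncilla_of_mem (fun w => (hD w).2.isProjectiveDecomposition) hP hQ).eq,
    key hQ hP] at h1
  have h2 := congrArg ((C.evolve N le_rfl)ᴴ * ·) h1
  simp only [← Matrix.mul_assoc, evolve_conjTranspose_mul, Matrix.one_mul] at h2
  exact h2.symm

/-- On a later wire, an ingoing projector is not influenced by an outgoing one: as it can be moved
to the beginning of the circuit, it may be applied first, although it comes last. -/
theorem commute_outgoing_ingoing {D : Side → ∀ w : B, Finset (C.WireOp w)}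
    (hD : C.IsPreferredSet B D) {w w' : B} (hw : w ≠ w') (hp : ¬ C.Precedes w' w)
    {P : C.WireOp w} {Q : C.WireOp w'} (hQ : Q ∈ D .ingoing w') :
    Commute (C.heisenberg w P) (C.heisenberg w' Q) := by
  rcases le_total (C.birth w) (C.birth w') with hb | hb
  · have h1 := partialTrace_broken_mul_onAncilla_mul hw hb P Q
    have : (onAncilla w P * onAncilla w' Q) ⊗ₖ (1 : Matrix (C.State 0) (C.State 0) ℂ) =
        (onAncilla w P ⊗ₖ (1 : Matrix (C.State 0) (C.State 0) ℂ)) *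
          (onAncilla w' Q ⊗ₖ (1 : Matrix (C.State 0) (C.State 0) ℂ)) := by
      rw [← mul_kronecker_mul, Matrix.mul_one]
    have hc : (onAncilla w P ⊗ₖ (1 : Matrix (C.State 0) (C.State 0) ℂ)) *
        ((1 : Matrix (C.Ancilla B) (C.Ancilla B) ℂ) ⊗ₖ C.heisenberg w' Q) =
          ((1 : Matrix (C.Ancilla B) (C.Ancilla B) ℂ) ⊗ₖ C.heisenberg w' Q) *
            (onAncilla w P ⊗ₖ (1 : Matrix (C.State 0) (C.State 0) ℂ)) := by
      rw [← mul_kronecker_mul, ← mul_kronecker_mul]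
      simp
    rw [this, ← Matrix.mul_assoc, ← partialTrace_kronecker_one_mul, ← Matrix.mul_assoc,
      onAncilla_mul_broken hD hQ, Matrix.mul_assoc, ← hc, ← Matrix.mul_assoc,
      partialTrace_mul_one_kronecker, partialTrace_broken_mul_onAncilla] at h1
    have h2 := congrArg ((C.evolve N le_rfl)ᴴ * ·) h1
    simp only [← Matrix.mul_assoc, evolve_conjTranspose_mul, Matrix.one_mul] at h2
    exact h2
  · -- The wires are spacelike separated, so any two operators on them commute.
    exact (C.commute_heisenberg_of_not_precedes (fun h => hw (Subtype.ext h.symm)) hp hb Q P).symm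

end UnitaryCircuit

theorem mainTheorem2 {W : Type*} [Fintype W] [DecidableEq W] {N : ℕ} (C : UnitaryCircuit W N)
    (B : Finset W) {n : ℕ} (A : Fin n ≃ B)
    (hA : ∀ m k : Fin n, C.Precedes (A m) (A k) → m < k)
    (D : UnitaryCircuit.Side → ∀ w : B, Finset (C.WireOp w))
    (hD : C.IsPreferredSet B D) :
    (∀ (s : UnitaryCircuit.Side) (m : Fin n) (s' : UnitaryCircuit.Side) (k : Fin n),
      C.Influences D A s m s' k → s = .ingoing ∧ s' = .outgoing ∧ m ≤ k) ∧
    (∀ m k : Fin n, ∀ P ∈ D .outgoing (A m), ∀ Q ∈ D .outgoing (A k),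
      Commute (C.heisenberg (A m) P) (C.heisenberg (A k) Q)) ∧
    (∀ m k : Fin n, ∀ P ∈ D .ingoing (A m), ∀ Q ∈ D .ingoing (A k),
      Commute (C.heisenberg (A m) P) (C.heisenberg (A k) Q)) ∧
    (∀ m k : Fin n, m < k → ∀ P ∈ D .outgoing (A m), ∀ Q ∈ D .ingoing (A k),
      Commute (C.heisenberg (A m) P) (C.heisenberg (A k) Q)) := by
  have hin : ∀ m k : Fin n, m < k → ∀ P ∈ D .outgoing (A m), ∀ Q ∈ D .ingoing (A k),
      Commute (C.heisenberg (A m) P) (C.heisenberg (A k) Q) := fun m k hmk P _ Q hQ =>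
    UnitaryCircuit.commute_outgoing_ingoing hD (fun h => hmk.ne (A.injective h))
      (fun h => hmk.not_gt (hA k m h)) hQ
  refine ⟨?_, fun m k P hP Q hQ => UnitaryCircuit.commute_outgoing hD hP hQ,
    fun m k P hP Q hQ => UnitaryCircuit.commute_ingoing hD hP hQ, hin⟩
  rintro (_ | _) m (_ | _) k ⟨hbelow, P, hP, Q, hQ, hPQ⟩
  · exact absurd (UnitaryCircuit.commute_ingoing hD hP hQ) hPQ
  · exact ⟨rfl, rfl, hbelow.elim le_of_lt fun h => h.1.le⟩
  · rcases hbelow with hmk | ⟨_, h, _⟩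
    · exact absurd (hin m k hmk P hP Q hQ) hPQ
    · cases h
  · exact absurd (UnitaryCircuit.commute_outgoing hD hP hQ) hPQ
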